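/- Let $D=2n$, let $\theta$ be a nonzero real number and let $\Theta=\theta\,\mathrm{diag}(J,\dots,J)$ with $n$ blocks $J=\begin{pmatrix}0&-1\\1&0\end{pmatrix}$. For Schwartz functions $a,b\in\mathcal S=\mathcal S(\mathbb R^D)$ (complex valued) let $$(a\star b)(x)=\frac1{(\pi\theta)^D}\int d^Dy\,d^Dz\;a(x+y)\,b(x+z)\,e^{-2i\,y\Theta^{-1}z}\in\mathcal S .$$ For a tempered distribution $T\in\mathcal S'$ and $a\in\mathcal S$ define $T\star a,\ a\star T\in\mathcal S'$ by $\langle T\star a,b\rangle=\langle T,a\star b\rangle$ and $\langle a\star T,b\rangle=\langle T,b\star a\rangle$. The Moyal algebra $\mathcal M$ is the set of $T\in\mathcal S'$ such that $T\star a\in\mathcal S$ and $a\star T\in\mathcal S$ for all $a\in\mathcal S$. For $R,T\in\mathcal M$ the product $R\star T$ is given by $\langle R\star T,a\rangle=\langle R,T\star a\rangle$ for $a\in\mathcal S$, and the Moyal bracket is $[R,T]_\star=R\star T-T\star R$. Let $\mathcal P_2$ be the set of polynomial functions on $\mathbb R^D$ with complex coefficients and degree $\le 2$, regarded as tempered distributions,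 and for polynomial functions let $\{a,b\}_{PB}=\sum_{\mu,\nu}\Theta_{\mu\nu}\,\frac{\partial a}{\partial x_\mu}\frac{\partial b}{\partial x_\nu}$. Then $\mathcal P_2\subset\mathcal M$; the set $\mathcal P_2$ is closed under the Moyal bracket and is a complex Lie algebra for it; and $$[P_1,P_2]_\star=i\,\{P_1,P_2\}_{PB}\qquad\text{for all }P_1,P_2\in\mathcal P_2 .$$ -/

import Mathlib

namespace Moyal

open MeasureTheory FourierTransform SchwartzMap
open scoped ContDiff Matrix

section Aux

variable {E : Type} [NormedAddCommGroup E] [InnerProductSpace ℝ E]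

lemma norm_iteratedFDeriv_comp_le_of_contraction {V : Type} [NormedAddCommGroup V] [NormedSpace ℝ V]
    (f : 𝓢(E, ℂ)) (L : V →L[ℝ] E) (hL : ‖L‖ ≤ 1) (n : ℕ) (w : V) :
    ‖iteratedFDeriv ℝ n (fun w => f (L w)) w‖ ≤ ‖iteratedFDeriv ℝ n f (L w)‖ := by
  have h := L.iteratedFDeriv_comp_right (f.smooth ⊤) w (i := n) (mod_cast le_top)
  change ‖iteratedFDeriv ℝ n (f ∘ L) w‖ ≤ _
  rw [h]
  refine (ContinuousMultilinearMap.norm_compContinuousLinearMap_le _ _).trans ?_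
  refine mul_le_of_le_one_right (norm_nonneg _) ?_
  exact Finset.prod_le_one (fun _ _ => norm_nonneg _) (fun _ _ => hL)

/-- For a fixed Schwartz function `a`, the map sending `b` to `(y, x) ↦ a y * b x`. -/
noncomputable def tensorCLM (a : 𝓢(E, ℂ)) : 𝓢(E, ℂ) →L[ℂ] 𝓢(WithLp 2 (E × E), ℂ) :=
  mkCLM (fun b w => a w.fst * b w.snd) (fun _ _ _ => by simp [mul_add])
    (fun _ _ _ => by simp [mul_left_comm])
    (fun b => ((a.smooth ⊤).comp (WithLp.fstL 2 ℝ E E).contDiff).mul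
      ((b.smooth ⊤).comp (WithLp.sndL 2 ℝ E E).contDiff)) <| by
  rintro ⟨k, n⟩
  have hn1 : ‖WithLp.fstL 2 ℝ E E‖ ≤ 1 :=
    ContinuousLinearMap.opNorm_le_bound _ zero_le_one fun w => by
      simpa using WithLp.norm_fst_le (p := 2) (x := w)
  have hn2 : ‖WithLp.sndL 2 ℝ E E‖ ≤ 1 :=
    ContinuousLinearMap.opNorm_le_bound _ zero_le_one fun w => by
      simpa using WithLp.norm_snd_le (p := 2) (x := w)
  set A : ℝ := 2 ^ k * (Finset.Iic (k, n)).sup (schwartzSeminormFamily ℂ E ℂ) a with hA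
  refine ⟨Finset.Iic (k, n), ∑ i ∈ Finset.range (n + 1), n.choose i * A * 2 ^ k,
    by positivity, fun b w => ?_⟩
  set B : ℝ := (Finset.Iic (k, n)).sup (schwartzSeminormFamily ℂ E ℂ) b with hB
  have hmul := norm_iteratedFDeriv_mul_le (𝕜 := ℝ) (N := ∞) (n := n)
    ((a.smooth ⊤).comp (WithLp.fstL 2 ℝ E E).contDiff)
    ((b.smooth ⊤).comp (WithLp.sndL 2 ℝ E E).contDiff) w (mod_cast le_top)
  have hw : ‖w‖ ≤ ‖w.fst‖ + ‖w.snd‖ := by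
    rw [WithLp.prod_norm_eq_of_L2]
    refine Real.sqrt_le_iff.2 ⟨by positivity, ?_⟩
    nlinarith [norm_nonneg w.fst, norm_nonneg w.snd]
  have hw' : ‖w‖ ^ k ≤ (1 + ‖w.fst‖) ^ k * (1 + ‖w.snd‖) ^ k := by
    rw [← mul_pow]
    gcongr
    nlinarith [norm_nonneg w.fst, norm_nonneg w.snd]
  calc ‖w‖ ^ k * ‖iteratedFDeriv ℝ n (fun w : WithLp 2 (E × E) => a w.fst * b w.snd) w‖
      ≤ ((1 + ‖w.fst‖) ^ k * (1 + ‖w.snd‖) ^ k) *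
        ∑ i ∈ Finset.range (n + 1), (n.choose i : ℝ) *
          ‖iteratedFDeriv ℝ i a w.fst‖ * ‖iteratedFDeriv ℝ (n - i) b w.snd‖ := by
        refine mul_le_mul hw' (hmul.trans ?_) (norm_nonneg _) (by positivity)
        refine Finset.sum_le_sum fun i _ => ?_
        gcongr
        · exact norm_iteratedFDeriv_comp_le_of_contraction a (WithLp.fstL 2 ℝ E E) hn1 i w
        · exact norm_iteratedFDeriv_comp_le_of_contraction b (WithLp.sndL 2 ℝ E E) hn2 (n - i) w
    _ ≤ (∑ i ∈ Finset.range (n + 1), n.choose i * A * 2 ^ k) * B := by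
        rw [Finset.mul_sum, Finset.sum_mul]
        refine Finset.sum_le_sum fun i hi => ?_
        have hi' : i ≤ n := Nat.lt_succ_iff.1 (Finset.mem_range.1 hi)
        have h1 := one_add_le_sup_seminorm_apply (𝕜 := ℂ) (m := (k, n)) le_rfl hi' a w.fst
        have h2 := one_add_le_sup_seminorm_apply (𝕜 := ℂ) (m := (k, n)) le_rfl
          (Nat.sub_le n i) b w.snd
        calc _ = (n.choose i : ℝ) * ((1 + ‖w.fst‖) ^ k * ‖iteratedFDeriv ℝ i a w.fst‖) *
              ((1 + ‖w.snd‖) ^ k * ‖iteratedFDeriv ℝ (n - i) b w.snd‖) := by ring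
          _ ≤ (n.choose i : ℝ) * A * (2 ^ k * B) :=
              mul_le_mul (mul_le_mul_of_nonneg_left h1 (by positivity)) h2 (by positivity)
                (by positivity)
          _ = _ := by ring

lemma tensorCLM_apply (a b : 𝓢(E, ℂ)) (w : WithLp 2 (E × E)) :
    tensorCLM a b w = a w.fst * b w.snd := rfl


/-- The embedding `x ↦ (0, x)`. -/
noncomputable def sndEmb (E : Type) [NormedAddCommGroup E] [InnerProductSpace ℝ E] :
    E →L[ℝ] WithLp 2 (E × E) :=
  (WithLp.prodContinuousLinearEquiv 2 ℝ E E).symm.toContinuousLinearMap ∘L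
    ContinuousLinearMap.inr ℝ E E

lemma sndEmb_apply (x : E) : sndEmb E x = WithLp.toLp 2 (0, x) := rfl

lemma antilipschitz_sndEmb : AntilipschitzWith 1 (sndEmb E) :=
  (AddMonoidHomClass.isometry_of_norm (sndEmb E) fun x => by
    simp [sndEmb_apply]).antilipschitz

section Marginal

variable [FiniteDimensional ℝ E] [MeasurableSpace E] [BorelSpace E]

/-- The continuous linear map `G ↦ (x ↦ ∫ y, G (y, x))` on Schwartz functions. -/
noncomputable def marginalCLM : 𝓢(WithLp 2 (E × E), ℂ) →L[ℂ] 𝓢(E, ℂ) :=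
  (fourierInvCLM ℂ 𝓢(E, ℂ)) ∘L
    (compCLMOfAntilipschitz ℂ (sndEmb E).hasTemperateGrowth antilipschitz_sndEmb) ∘L
    (fourierCLM ℂ 𝓢(WithLp 2 (E × E), ℂ))

lemma integrable_prod (G : 𝓢(WithLp 2 (E × E), ℂ)) :
    Integrable (fun p : E × E => G (WithLp.toLp 2 p)) (volume.prod volume) :=
  ((WithLp.volume_preserving_toLp E E).integrable_comp_emb
    (MeasurableEquiv.toLp 2 (E × E)).measurableEmbedding).2 G.integrable

lemma continuous_marginal (G : 𝓢(WithLp 2 (E × E), ℂ)) :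
    Continuous fun x : E => ∫ y : E, G (WithLp.toLp 2 (y, x)) := by
  set r := (volume : Measure E).integrablePower
  set C := 2 ^ r * ((Finset.Iic (r, 0)).sup fun m => SchwartzMap.seminorm ℂ m.1 m.2) G
  refine continuous_of_dominated (bound := fun y => C * (1 + ‖y‖) ^ (-(r : ℝ))) ?_ ?_ ?_ ?_
  · intro x
    exact (G.continuous.comp (by fun_prop)).aestronglyMeasurable
  · intro x
    refine Filter.Eventually.of_forall fun y => ?_
    have h := one_add_le_sup_seminorm_apply (𝕜 := ℂ) (m := (r, 0)) le_rfl le_rfl G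
      (WithLp.toLp 2 (y, x))
    rw [norm_iteratedFDeriv_zero] at h
    have h2 : ‖y‖ ≤ ‖WithLp.toLp 2 (y, x)‖ := by
      simpa using WithLp.norm_fst_le (p := 2) (x := WithLp.toLp 2 (y, x))
    rw [Real.rpow_neg (by positivity), Real.rpow_natCast, ← div_eq_mul_inv,
      le_div_iff₀ (by positivity), mul_comm]
    refine le_trans ?_ h
    gcongr
  · exact (Measure.integrable_pow_neg_integrablePower volume).const_mul C
  · exact Filter.Eventually.of_forall fun y => G.continuous.comp (by fun_prop)

lemma marginalCLM_apply (G : 𝓢(WithLp 2 (E × E), ℂ)) (x : E) :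
    marginalCLM G x = ∫ y : E, G (WithLp.toLp 2 (y, x)) := by
  set h : E → ℂ := fun x => ∫ y : E, G (WithLp.toLp 2 (y, x)) with hh
  set R : 𝓢(E, ℂ) :=
    compCLMOfAntilipschitz ℂ (sndEmb E).hasTemperateGrowth antilipschitz_sndEmb (𝓕 G) with hR
  have hint : Integrable h := (integrable_prod G).integral_prod_right
  have hF : 𝓕 h = R := by
    funext w
    have hRw : R w = 𝓕 (G : WithLp 2 (E × E) → ℂ) (WithLp.toLp 2 (0, w)) := rfl
    rw [hRw, Real.fourier_eq, Real.fourier_eq,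
      ← (WithLp.volume_preserving_toLp E E).integral_comp
        (MeasurableEquiv.toLp 2 (E × E)).measurableEmbedding]
    change _ = ∫ p : E × E, _ ∂(volume.prod volume)
    rw [integral_prod_symm]
    · refine integral_congr_ae (Filter.Eventually.of_forall fun x => ?_)
      change 𝐞 (-inner ℝ x w) • (∫ y : E, G (WithLp.toLp 2 (y, x))) = ∫ y : E,
        𝐞 (-inner ℝ (WithLp.toLp 2 (y, x)) (WithLp.toLp 2 ((0 : E), w))) • G (WithLp.toLp 2 (y, x))
      simp only [Circle.smul_def, smul_eq_mul, WithLp.prod_inner_apply, inner_zero_right, zero_add]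
      rw [integral_const_mul]
    · refine (integrable_prod G).mono ?_ (Filter.Eventually.of_forall fun p => by
        simp [Circle.smul_def, Circle.norm_coe])
      refine Continuous.aestronglyMeasurable ?_
      have := G.continuous
      fun_prop
  have : (marginalCLM G : E → ℂ) = 𝓕⁻ (R : E → ℂ) := SchwartzMap.fourierInv_coe R
  rw [this, ← hF, (continuous_marginal G).fourierInv_fourier_eq hint (by rw [hF]; exact R.integrable)]

end Marginal

lemma hasTemperateGrowth_exp_I : (fun t : ℝ => Complex.exp (Complex.I * t)).HasTemperateGrowth := by
  have h0 : ContDiff ℝ ∞ (fun t : ℝ => Complex.exp (Complex.I * t)) :=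
    (contDiff_const.mul Complex.ofRealCLM.contDiff).cexp
  refine ⟨h0, fun n => ⟨0, 1, fun t => ?_⟩⟩
  rw [norm_iteratedFDeriv_eq_norm_iteratedDeriv]
  have h : ∀ n : ℕ, iteratedDeriv n (fun t : ℝ => Complex.exp (Complex.I * t)) =
      fun t : ℝ => Complex.I ^ n * Complex.exp (Complex.I * t) := by
    intro n
    induction n with
    | zero => simp
    | succ n ih =>
      rw [iteratedDeriv_succ, ih]
      funext t
      have h1 : HasDerivAt (fun t : ℝ => Complex.I * (t : ℂ)) Complex.I t := by
        simpa using (Complex.ofRealCLM.hasDerivAt (x := t)).const_mul Complex.I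
      rw [(h1.cexp.const_mul _).deriv]
      ring
  rw [h]
  simp [mul_comm Complex.I, Complex.norm_exp_ofReal_mul_I]

/-- The linear automorphism `(y, x) ↦ (x + y, y)`. -/
noncomputable def shear (E : Type) [NormedAddCommGroup E] [InnerProductSpace ℝ E]
    [FiniteDimensional ℝ E] : WithLp 2 (E × E) ≃L[ℝ] WithLp 2 (E × E) :=
  LinearEquiv.toContinuousLinearEquiv
    { toFun := fun w => WithLp.toLp 2 (w.snd + w.fst, w.fst)
      invFun := fun w => WithLp.toLp 2 (w.snd, w.fst - w.snd)
      map_add' := fun v w => by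
        refine WithLp.ofLp_injective 2 (Prod.ext ?_ ?_) <;> simp [add_add_add_comm]
      map_smul' := fun c w => by
        refine WithLp.ofLp_injective 2 (Prod.ext ?_ ?_) <;> simp [smul_add]
      left_inv := fun w => by
        refine WithLp.ofLp_injective 2 (Prod.ext ?_ ?_) <;> simp
      right_inv := fun w => by
        refine WithLp.ofLp_injective 2 (Prod.ext ?_ ?_) <;> simp }

/-- The linear automorphism `(y, x) ↦ (x, y)`. -/
noncomputable def swap (E : Type) [NormedAddCommGroup E] [InnerProductSpace ℝ E]
    [FiniteDimensional ℝ E] : WithLp 2 (E × E) ≃L[ℝ] WithLp 2 (E × E) :=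
  LinearEquiv.toContinuousLinearEquiv
    { toFun := fun w => WithLp.toLp 2 (w.snd, w.fst)
      invFun := fun w => WithLp.toLp 2 (w.snd, w.fst)
      map_add' := fun v w => by
        refine WithLp.ofLp_injective 2 (Prod.ext ?_ ?_) <;> simp
      map_smul' := fun c w => by
        refine WithLp.ofLp_injective 2 (Prod.ext ?_ ?_) <;> simp
      left_inv := fun w => by
        refine WithLp.ofLp_injective 2 (Prod.ext ?_ ?_) <;> simp
      right_inv := fun w => by
        refine WithLp.ofLp_injective 2 (Prod.ext ?_ ?_) <;> simp }

/-- The oscillating factor `(y, x) ↦ exp (2 i ⟪x, A y⟫)`. -/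
noncomputable def phase (A : E ≃L[ℝ] E) (w : WithLp 2 (E × E)) : ℂ :=
  Complex.exp (Complex.I * ((2 * inner ℝ w.snd (A w.fst) : ℝ) : ℂ))

lemma phase_apply (A : E ≃L[ℝ] E) (x y : E) : phase A (WithLp.toLp 2 (y, x)) =
    Complex.exp (Complex.I * ((2 * inner ℝ x (A y) : ℝ) : ℂ)) := rfl

lemma hasTemperateGrowth_phase (A : E ≃L[ℝ] E) : (phase A).HasTemperateGrowth := by
  have h1 : (fun w : WithLp 2 (E × E) => w.snd).HasTemperateGrowth :=
    (WithLp.sndL 2 ℝ E E).hasTemperateGrowth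
  have h2 : (fun w : WithLp 2 (E × E) => A w.fst).HasTemperateGrowth :=
    (A.toContinuousLinearMap ∘L WithLp.fstL 2 ℝ E E).hasTemperateGrowth
  have h3 : (fun w : WithLp 2 (E × E) => inner ℝ w.snd (A w.fst)).HasTemperateGrowth :=
    (innerSL ℝ).bilinear_hasTemperateGrowth h1 h2
  exact hasTemperateGrowth_exp_I.comp ((Function.HasTemperateGrowth.const (2 : ℝ)).mul h3)

variable [FiniteDimensional ℝ E] [MeasurableSpace E] [BorelSpace E]

/-- The function `y ↦ 𝓕 b (A y / π)`. -/
noncomputable def scaledFourierCLM (A : E ≃L[ℝ] E) : 𝓢(E, ℂ) →L[ℂ] 𝓢(E, ℂ) :=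
  compCLMOfContinuousLinearEquiv ℂ
    (A.trans (ContinuousLinearEquiv.smulLeft (Units.mk0 (Real.pi⁻¹) (by positivity)))) ∘L
    fourierCLM ℂ 𝓢(E, ℂ)

/-- Integration over `y` of `(y, x) ↦ exp (2 i ⟪x, A y⟫) G (x + y, y)`. -/
noncomputable def twistCLM (A : E ≃L[ℝ] E) : 𝓢(WithLp 2 (E × E), ℂ) →L[ℂ] 𝓢(E, ℂ) :=
  marginalCLM ∘L smulLeftCLM ℂ (phase A) ∘L compCLMOfContinuousLinearEquiv ℂ (shear E)

lemma twistCLM_apply (A : E ≃L[ℝ] E) (a b : 𝓢(E, ℂ)) (x : E) :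
    twistCLM A (tensorCLM a (scaledFourierCLM A b)) x =
      ∫ y : E, ∫ z : E, a (x + y) * b (x + z) *
        Complex.exp (-(2 * Complex.I * (inner ℝ z (A y) : ℝ))) := by
  change marginalCLM _ x = _
  rw [marginalCLM_apply]
  refine integral_congr_ae (Filter.Eventually.of_forall fun y => ?_)
  change smulLeftCLM ℂ (phase A) (compCLMOfContinuousLinearEquiv ℂ (shear E)
    (tensorCLM a (scaledFourierCLM A b))) (WithLp.toLp 2 (y, x)) = _
  rw [smulLeftCLM_apply_apply (hasTemperateGrowth_phase A)]
  change phase A (WithLp.toLp 2 (y, x)) • (a (x + y) * 𝓕 (b : E → ℂ) (Real.pi⁻¹ • A y)) =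
    ∫ z : E, a (x + y) * b (x + z) * Complex.exp (-(2 * Complex.I * (inner ℝ z (A y) : ℝ)))
  rw [← integral_add_left_eq_self (μ := (volume : Measure E)) _ (-x), Real.fourier_eq,
    smul_eq_mul, ← mul_assoc, ← integral_const_mul]
  refine integral_congr_ae (Filter.Eventually.of_forall fun z => ?_)
  simp only [phase_apply, Circle.smul_def, smul_eq_mul, Real.fourierChar_apply, add_neg_cancel_left,
    inner_add_left, inner_neg_left, inner_smul_right]
  have hpi : (Real.pi : ℂ) ≠ 0 := by exact_mod_cast Real.pi_ne_zero
  have : Complex.exp (-(2 * Complex.I * ((-inner ℝ x (A y) + inner ℝ z (A y) : ℝ) : ℂ))) =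
      Complex.exp (Complex.I * ((2 * inner ℝ x (A y) : ℝ) : ℂ)) *
      Complex.exp (((2 * Real.pi * -(Real.pi⁻¹ * inner ℝ z (A y)) : ℝ) : ℂ) * Complex.I) := by
    rw [← Complex.exp_add]
    congr 1
    push_cast
    field_simp
    ring
  rw [this]
  ring

end Aux

noncomputable section Algebra

/-- The space `ℝ ^ D`, `D = 2 n`: the pair `(i, k)` stands for the `i`-th coordinate of the `k`-th
plane. -/
abbrev Space (n : ℕ) : Type := EuclideanSpace ℝ (Fin 2 × Fin n)

/-- The block-diagonal matrix `diag (J, …, J)` with `n` blocks `J`. -/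
def sigma (n : ℕ) : Matrix (Fin 2 × Fin n) (Fin 2 × Fin n) ℝ :=
  Matrix.blockDiagonal fun _ => !![0, -1; 1, 0]

/-- `Θ = θ Σ`. -/
def theta (n : ℕ) (θ : ℝ) : Matrix (Fin 2 × Fin n) (Fin 2 × Fin n) ℝ := θ • sigma n

variable {n : ℕ} {θ : ℝ}

lemma sigma_mul_sigma (n : ℕ) : sigma n * sigma n = -1 := by
  have h : (!![0, -1; 1, 0] : Matrix (Fin 2) (Fin 2) ℝ) * !![0, -1; 1, 0] = -1 := by
    ext i j; fin_cases i <;> fin_cases j <;> simp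
  rw [sigma, ← Matrix.blockDiagonal_mul, h, ← Matrix.blockDiagonal_one, ← Matrix.blockDiagonal_neg]
  rfl

lemma theta_mul_inv (hθ : θ ≠ 0) : theta n θ * (theta n θ)⁻¹ = 1 := by
  refine Matrix.mul_nonsing_inv _ ?_
  refine (Matrix.isUnit_iff_isUnit_det _).1 ?_
  have h : theta n θ * ((-θ⁻¹) • sigma n) = 1 := by
    simp [theta, sigma_mul_sigma, smul_smul, hθ]
  exact IsUnit.of_mul_eq_one _ h

/-- The linear automorphism `A` of `ℝ ^ D` with `⟪z, A y⟫ = y Θ⁻¹ z`. -/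
def invEquiv (n : ℕ) (hθ : θ ≠ 0) : Space n ≃L[ℝ] Space n :=
  LinearEquiv.toContinuousLinearEquiv
    (LinearEquiv.ofLinearMap (Matrix.toLpLin 2 2 ((theta n θ)⁻¹)ᵀ) (Matrix.toLpLin 2 2 (theta n θ)ᵀ)
      (by rw [← Matrix.toLpLin_mul_same, ← Matrix.transpose_mul, theta_mul_inv hθ]; simp)
      (by rw [← Matrix.toLpLin_mul_same, ← Matrix.transpose_mul,
            mul_eq_one_comm.1 (theta_mul_inv hθ)]; simp))

lemma inner_invEquiv (hθ : θ ≠ 0) (y z : Space n) :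
    inner ℝ z (invEquiv n hθ y) = y.ofLp ⬝ᵥ (theta n θ)⁻¹ *ᵥ z.ofLp := by
  change inner ℝ z (Matrix.toLpLin 2 2 ((theta n θ)⁻¹)ᵀ y) = _
  rw [EuclideanSpace.inner_eq_star_dotProduct, Matrix.ofLp_toLpLin, star_trivial,
    Matrix.toLin'_apply, Matrix.mulVec_transpose, Matrix.dotProduct_mulVec]

/-- The integral formula
`(a ⋆ b)(x) = (π θ)^(-D) ∫ dy dz a(x + y) b(x + z) exp (- 2 i y Θ⁻¹ z)`. -/
def starFun (θ : ℝ) (a b : 𝓢(Space n, ℂ)) (x : Space n) : ℂ :=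
  (((Real.pi * θ) ^ (2 * n) : ℝ) : ℂ)⁻¹ * ∫ y : Space n, ∫ z : Space n, a (x + y) * b (x + z) *
    Complex.exp (-(2 * Complex.I * ((y.ofLp ⬝ᵥ (theta n θ)⁻¹ *ᵥ z.ofLp : ℝ) : ℂ)))

/-- Auxiliary form of `b ↦ a ⋆ b`. -/
def starAuxLeft (hθ : θ ≠ 0) (a : 𝓢(Space n, ℂ)) : 𝓢(Space n, ℂ) →L[ℂ] 𝓢(Space n, ℂ) :=
  (((Real.pi * θ) ^ (2 * n) : ℝ) : ℂ)⁻¹ •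
    (twistCLM (invEquiv n hθ) ∘L tensorCLM a ∘L scaledFourierCLM (invEquiv n hθ))

/-- Auxiliary form of `a ↦ a ⋆ b`. -/
def starAuxRight (hθ : θ ≠ 0) (b : 𝓢(Space n, ℂ)) : 𝓢(Space n, ℂ) →L[ℂ] 𝓢(Space n, ℂ) :=
  (((Real.pi * θ) ^ (2 * n) : ℝ) : ℂ)⁻¹ •
    (twistCLM (invEquiv n hθ) ∘L compCLMOfContinuousLinearEquiv ℂ (swap (Space n)) ∘L
      tensorCLM (scaledFourierCLM (invEquiv n hθ) b))

lemma starAuxLeft_apply (hθ : θ ≠ 0) (a b : 𝓢(Space n, ℂ)) (x : Space n) :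
    starAuxLeft hθ a b x = starFun θ a b x := by
  change _ * twistCLM (invEquiv n hθ) (tensorCLM a (scaledFourierCLM (invEquiv n hθ) b)) x = _
  simp only [twistCLM_apply, starFun, inner_invEquiv]

lemma starAuxRight_eq (hθ : θ ≠ 0) (a b : 𝓢(Space n, ℂ)) :
    starAuxRight hθ b a = starAuxLeft hθ a b := by
  have h : compCLMOfContinuousLinearEquiv ℂ (swap (Space n))
      (tensorCLM (scaledFourierCLM (invEquiv n hθ) b) a) =
      tensorCLM a (scaledFourierCLM (invEquiv n hθ) b) := by
    ext w
    exact mul_comm _ _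
  exact congrArg (fun G => (((Real.pi * θ) ^ (2 * n) : ℝ) : ℂ)⁻¹ • twistCLM (invEquiv n hθ) G) h

variable [NeZero θ]

variable (θ) in
/-- The Moyal product `⋆ : 𝓢 × 𝓢 → 𝓢`. -/
def star (a b : 𝓢(Space n, ℂ)) : 𝓢(Space n, ℂ) where
  toFun := starFun θ a b
  smooth' := by
    rw [← funext (starAuxLeft_apply (NeZero.ne θ) a b)]
    exact (starAuxLeft (NeZero.ne θ) a b).smooth'
  decay' := by
    rw [← funext (starAuxLeft_apply (NeZero.ne θ) a b)]
    exact (starAuxLeft (NeZero.ne θ) a b).decay'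

lemma star_eq_left (a b : 𝓢(Space n, ℂ)) : star θ a b = starAuxLeft (NeZero.ne θ) a b :=
  SchwartzMap.ext fun x => (starAuxLeft_apply (NeZero.ne θ) a b x).symm

lemma star_eq_right (a b : 𝓢(Space n, ℂ)) : star θ a b = starAuxRight (NeZero.ne θ) b a := by
  rw [star_eq_left, starAuxRight_eq]

variable (θ) in
/-- The continuous linear map `b ↦ a ⋆ b` on `𝓢`. -/
def starLeftCLM (a : 𝓢(Space n, ℂ)) : 𝓢(Space n, ℂ) →L[ℂ] 𝓢(Space n, ℂ) where
  toFun b := star θ a b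
  map_add' b c := by simp only [star_eq_left, map_add]
  map_smul' r b := by simp only [star_eq_left, map_smul, RingHom.id_apply]
  cont := by simpa only [star_eq_left] using (starAuxLeft (NeZero.ne θ) a).continuous

variable (θ) in
/-- The continuous linear map `a ↦ a ⋆ b` on `𝓢`. -/
def starRightCLM (b : 𝓢(Space n, ℂ)) : 𝓢(Space n, ℂ) →L[ℂ] 𝓢(Space n, ℂ) where
  toFun a := star θ a b
  map_add' a c := by simp only [star_eq_right, map_add]
  map_smul' r a := by simp only [star_eq_right, map_smul, RingHom.id_apply]
  cont := by simpa only [star_eq_right] using (starAuxRight (NeZero.ne θ) b).continuous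

variable (θ) in
/-- `T ⋆ a` for a tempered distribution `T`: `⟨T ⋆ a, b⟩ = ⟨T, a ⋆ b⟩`. -/
def distStar (T : 𝓢'(Space n, ℂ)) (a : 𝓢(Space n, ℂ)) : 𝓢'(Space n, ℂ) :=
  PointwiseConvergenceCLM.precomp ℂ (starLeftCLM θ a) T

variable (θ) in
/-- `a ⋆ T` for a tempered distribution `T`: `⟨a ⋆ T, b⟩ = ⟨T, b ⋆ a⟩`. -/
def starDist (a : 𝓢(Space n, ℂ)) (T : 𝓢'(Space n, ℂ)) : 𝓢'(Space n, ℂ) :=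
  PointwiseConvergenceCLM.precomp ℂ (starRightCLM θ a) T

lemma distStar_apply (T : 𝓢'(Space n, ℂ)) (a b : 𝓢(Space n, ℂ)) :
    distStar θ T a b = T (star θ a b) := rfl

lemma starDist_apply (T : 𝓢'(Space n, ℂ)) (a b : 𝓢(Space n, ℂ)) :
    starDist θ a T b = T (star θ b a) := rfl

/-- The embedding of `𝓢` into `𝓢'`, `⟨f, g⟩ = ∫ f g`. -/
abbrev emb : 𝓢(Space n, ℂ) →L[ℂ] 𝓢'(Space n, ℂ) :=
  toTemperedDistributionCLM (Space n) ℂ volume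

lemma emb_injective : Function.Injective (emb (n := n)) := by
  intro f g h
  rw [emb, ← Lp.toTemperedDistribution_toLp_eq (p := 2), ← Lp.toTemperedDistribution_toLp_eq (p := 2)] at h
  have hk := LinearMap.ker_eq_bot.1
    (Lp.ker_toTemperedDistributionCLM_eq_bot (E := Space n) (F := ℂ) (μ := volume) (p := 2))
  exact injective_toLp 2 volume (hk h)

variable (n θ) in
/-- `𝓜_L = {T ∈ 𝓢' | a ⋆ T ∈ 𝓢 for all a ∈ 𝓢}`. -/
def multL : Submodule ℂ 𝓢'(Space n, ℂ) where
  carrier := {T | ∀ a : 𝓢(Space n, ℂ), ∃ f : 𝓢(Space n, ℂ), emb f = starDist θ a T}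
  zero_mem' a := ⟨0, by rw [map_zero, starDist, map_zero]⟩
  add_mem' {S T} hS hT a := by
    obtain ⟨f, hf⟩ := hS a
    obtain ⟨g, hg⟩ := hT a
    exact ⟨f + g, by rw [map_add, hf, hg, starDist, starDist, starDist, map_add]⟩
  smul_mem' c T hT a := by
    obtain ⟨f, hf⟩ := hT a
    exact ⟨c • f, by rw [map_smul, hf, starDist, starDist, map_smul]⟩

variable (n θ) in
/-- `𝓜_R = {T ∈ 𝓢' | T ⋆ a ∈ 𝓢 for all a ∈ 𝓢}`. -/
def multR : Submodule ℂ 𝓢'(Space n, ℂ) where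
  carrier := {T | ∀ a : 𝓢(Space n, ℂ), ∃ f : 𝓢(Space n, ℂ), emb f = distStar θ T a}
  zero_mem' a := ⟨0, by rw [map_zero, distStar, map_zero]⟩
  add_mem' {S T} hS hT a := by
    obtain ⟨f, hf⟩ := hS a
    obtain ⟨g, hg⟩ := hT a
    exact ⟨f + g, by rw [map_add, hf, hg, distStar, distStar, distStar, map_add]⟩
  smul_mem' c T hT a := by
    obtain ⟨f, hf⟩ := hT a
    exact ⟨c • f, by rw [map_smul, hf, distStar, distStar, map_smul]⟩

variable (n θ) in
/-- The Moyal algebra `𝓜 = 𝓜_L ∩ 𝓜_R`. -/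
def moyalAlgebra : Submodule ℂ 𝓢'(Space n, ℂ) := multL n θ ⊓ multR n θ

/-- For `T ∈ 𝓜`, the linear map `a ↦ T ⋆ a` from `𝓢` to `𝓢`. -/
def act (T : moyalAlgebra n θ) : 𝓢(Space n, ℂ) →ₗ[ℂ] 𝓢(Space n, ℂ) where
  toFun a := (T.2.2 a).choose
  map_add' a b := by
    apply emb_injective
    rw [map_add, (T.2.2 (a + b)).choose_spec, (T.2.2 a).choose_spec, (T.2.2 b).choose_spec]
    ext c
    change T.1 (star θ (a + b) c) = T.1 (star θ a c) + T.1 (star θ b c)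
    rw [← map_add]
    exact congrArg T.1 ((starRightCLM θ c).map_add a b)
  map_smul' r a := by
    apply emb_injective
    rw [map_smul, (T.2.2 (r • a)).choose_spec, (T.2.2 a).choose_spec]
    ext c
    change T.1 (star θ (r • a) c) = r • T.1 (star θ a c)
    rw [← map_smul]
    exact congrArg T.1 ((starRightCLM θ c).map_smul r a)

lemma emb_act (T : moyalAlgebra n θ) (a : 𝓢(Space n, ℂ)) :
    emb (act T a) = distStar θ T.1 a :=
  (T.2.2 a).choose_spec

/-- The product `R ⋆ T` of two elements of `𝓜`, by duality: `⟨R ⋆ T, a⟩ = ⟨R, T ⋆ a⟩`,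
as a linear form on `𝓢`. -/
def mul (R T : moyalAlgebra n θ) : 𝓢(Space n, ℂ) →ₗ[ℂ] ℂ :=
  R.1.toLinearMap ∘ₗ act T

/-- The Moyal bracket `[R, T] = R ⋆ T - T ⋆ R` of two elements of `𝓜`. -/
def bracket (R T : moyalAlgebra n θ) : 𝓢(Space n, ℂ) →ₗ[ℂ] ℂ := mul R T - mul T R

/-- The polynomial function on `ℝ ^ D` of a polynomial with complex coefficients. -/
def polyFun (p : MvPolynomial (Fin 2 × Fin n) ℂ) (x : Space n) : ℂ :=
  MvPolynomial.eval (fun i => (x i : ℂ)) p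

lemma hasTemperateGrowth_polyFun (p : MvPolynomial (Fin 2 × Fin n) ℂ) :
    (polyFun p).HasTemperateGrowth := by
  induction p using MvPolynomial.induction_on with
  | C c =>
    have : polyFun (n := n) (MvPolynomial.C c) = fun _ => c := by ext; simp [polyFun]
    rw [this]; exact .const c
  | add p q hp hq =>
    have : polyFun (p + q) = polyFun p + polyFun q := by ext; simp [polyFun]
    rw [this]; exact hp.add hq
  | mul_X p i hp =>
    have : polyFun (p * MvPolynomial.X i) =
        fun x => polyFun p x * (Complex.ofRealCLM ∘L EuclideanSpace.proj (𝕜 := ℝ) i) x := by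
      ext; simp [polyFun]
    rw [this]; exact hp.mul (ContinuousLinearMap.hasTemperateGrowth _)

/-- The polynomial function of `p` as a tempered distribution, `⟨p, f⟩ = ∫ f p`. -/
def polyDist : MvPolynomial (Fin 2 × Fin n) ℂ →ₗ[ℂ] 𝓢'(Space n, ℂ) where
  toFun p := (hasTemperateGrowth_polyFun p).toTemperedDistribution volume
  map_add' p q := by
    ext f
    have h (p : MvPolynomial (Fin 2 × Fin n) ℂ) : Integrable fun x : Space n => f x * polyFun p x :=
      (bilinLeftCLM (ContinuousLinearMap.mul ℂ ℂ) (hasTemperateGrowth_polyFun p) f).integrable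
    change ∫ x : Space n, f x * polyFun (p + q) x =
      (∫ x : Space n, f x * polyFun p x) + ∫ x : Space n, f x * polyFun q x
    rw [← integral_add (h p) (h q)]
    simp [polyFun, mul_add]
  map_smul' c p := by
    ext f
    change ∫ x : Space n, f x * polyFun (c • p) x = c * ∫ x : Space n, f x * polyFun p x
    rw [← integral_const_mul]
    simp [polyFun, mul_left_comm]

lemma polyDist_apply (p : MvPolynomial (Fin 2 × Fin n) ℂ) (f : 𝓢(Space n, ℂ)) :
    polyDist p f = ∫ x : Space n, f x * polyFun p x := rfl

variable (n) in
/-- The space `𝓟₂` of polynomial functions of degree at most `2`. -/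
def polyTwo : Submodule ℂ 𝓢'(Space n, ℂ) :=
  (MvPolynomial.restrictTotalDegree (Fin 2 × Fin n) ℂ 2).map polyDist

lemma polyDist_mem_polyTwo {p : MvPolynomial (Fin 2 × Fin n) ℂ} (hp : p.totalDegree ≤ 2) :
    polyDist p ∈ polyTwo n :=
  Submodule.mem_map_of_mem ((MvPolynomial.mem_restrictTotalDegree _ _ _).2 hp)

variable (θ) in
/-- The Poisson bracket `{p, q} = Θ_{μν} ∂_μ p ∂_ν q`. -/
def poisson (p q : MvPolynomial (Fin 2 × Fin n) ℂ) : MvPolynomial (Fin 2 × Fin n) ℂ :=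
  ∑ μ, ∑ ν, MvPolynomial.C ((theta n θ μ ν : ℝ) : ℂ) *
    MvPolynomial.pderiv μ p * MvPolynomial.pderiv ν q

end Algebra

end Moyal

/-!
Write `⋆` for the Moyal product and `θ_j` for the `j`-th column of `Θ`. Everything rests on two
identities between Schwartz functions,
`x_j (a ⋆ b) = (x_j a) ⋆ b + (i / 2) a ⋆ ∂_{θ_j} b` and `∫ a ⋆ b = ∫ a b`.
By the second one, constants act by scalar multiplication. By the dual form of the first one,
`(x_j T) ⋆ a = T ⋆ (x_j a) - (i / 2) ∂_{θ_j} (T ⋆ a)` and similarly for `a ⋆ (x_j T)`, so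
multiplication by a coordinate preserves the Moyal algebra, which therefore contains all
polynomials. The same identity gives the recursion in `q` that characterizes
`p ⋆ q = ∑ₖ (i / 2) ^ k / k! • Θ_{μ₁ν₁} ⋯ Θ_{μₖνₖ} ∂_{μ₁} ⋯ ∂_{μₖ} p ∂_{ν₁} ⋯ ∂_{νₖ} q`.
Exchanging `p` and `q` multiplies the `k`-th term by `(-1) ^ k`, so when `q` has degree at most two
only the term `k = 1`, the Poisson bracket, survives in the commutator.
-/

namespace Moyal

open MeasureTheory FourierTransform SchwartzMap LineDeriv
open scoped Matrix Nat

section PartialDerivatives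

variable {σ R : Type*} [CommRing R]

lemma pderiv_comm (i j : σ) (p : MvPolynomial σ R) :
    MvPolynomial.pderiv i (MvPolynomial.pderiv j p) =
      MvPolynomial.pderiv j (MvPolynomial.pderiv i p) := by
  classical
  have h : ⁅MvPolynomial.pderiv (R := R) i, MvPolynomial.pderiv j⁆ = 0 :=
    MvPolynomial.derivation_ext fun k => by
      rw [Derivation.commutator_apply, MvPolynomial.pderiv_X, MvPolynomial.pderiv_X,
        Pi.single_apply, Pi.single_apply]
      split_ifs <;> simp
  simpa [Derivation.commutator_apply, sub_eq_zero] using congr($h p)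

lemma totalDegree_pderiv_lt {i : σ} {p : MvPolynomial σ R} (h : MvPolynomial.pderiv i p ≠ 0) :
    (MvPolynomial.pderiv i p).totalDegree < p.totalDegree := by
  obtain ⟨m, hm, hdeg⟩ := Finset.exists_mem_eq_sup _ (MvPolynomial.support_nonempty.2 h)
    fun m : σ →₀ ℕ => m.sum fun _ e => e
  rw [MvPolynomial.mem_support_iff, MvPolynomial.coeff_pderiv] at hm
  have hle := MvPolynomial.le_totalDegree
    (MvPolynomial.mem_support_iff.2 (left_ne_zero_of_mul hm))
  rw [Finsupp.sum_add_index' (by simp) (by simp), Finsupp.sum_single_index rfl] at hle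
  exact hdeg.trans_lt hle

end PartialDerivatives

noncomputable section Contraction

variable {σ R : Type*} [Fintype σ] [CommRing R] {Θ : Matrix σ σ R} {p q : MvPolynomial σ R}

variable (Θ) in
/-- The `k`-fold contraction
`(p, q) ↦ ∑ Θ i₁ j₁ ⋯ Θ iₖ jₖ • (∂_{i₁} ⋯ ∂_{iₖ} p) (∂_{j₁} ⋯ ∂_{jₖ} q)`, i.e. the product after the
`k`-th power of the bidifferential operator `∑ Θ i j • ∂ᵢ ⊗ ∂ⱼ`. The first contraction is the
Poisson bracket of `Θ`, and the exponential series of the contractions is the Moyal product. -/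
def contraction : ℕ → MvPolynomial σ R →ₗ[R] MvPolynomial σ R →ₗ[R] MvPolynomial σ R
  | 0 => LinearMap.mul R (MvPolynomial σ R)
  | k + 1 => ∑ i, ∑ j, Θ i j • (contraction k).compl₁₂ (MvPolynomial.pderiv i).toLinearMap
      (MvPolynomial.pderiv j).toLinearMap

lemma contraction_zero_apply (Θ : Matrix σ σ R) (p q : MvPolynomial σ R) :
    contraction Θ 0 p q = p * q := rfl

lemma contraction_succ_apply (Θ : Matrix σ σ R) (k : ℕ) (p q : MvPolynomial σ R) :
    contraction Θ (k + 1) p q = ∑ i, ∑ j, Θ i j •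
      contraction Θ k (MvPolynomial.pderiv i p) (MvPolynomial.pderiv j q) := by
  simp [contraction]

lemma contraction_one_apply (Θ : Matrix σ σ R) (p q : MvPolynomial σ R) :
    contraction Θ 1 p q =
      ∑ i, ∑ j, Θ i j • (MvPolynomial.pderiv i p * MvPolynomial.pderiv j q) :=
  contraction_succ_apply Θ 0 p q

lemma contraction_transpose (Θ : Matrix σ σ R) (k : ℕ) (p q : MvPolynomial σ R) :
    contraction Θᵀ k p q = contraction Θ k q p := by
  induction k generalizing p q with
  | zero => exact mul_comm p q
  | succ k ih =>
    simp only [contraction_succ_apply, Matrix.transpose_apply, ih]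
    exact Finset.sum_comm

lemma contraction_smul_matrix (c : R) (Θ : Matrix σ σ R) (k : ℕ) (p q : MvPolynomial σ R) :
    contraction (c • Θ) k p q = c ^ k • contraction Θ k p q := by
  induction k generalizing p q with
  | zero => simp [contraction_zero_apply]
  | succ k ih =>
    simp only [contraction_succ_apply, ih, Matrix.smul_apply, smul_eq_mul, Finset.smul_sum,
      smul_smul]
    refine Finset.sum_congr rfl fun i _ => Finset.sum_congr rfl fun j _ => ?_
    congr 1
    ring

lemma contraction_swap (hΘ : Θᵀ = -Θ) (k : ℕ) (p q : MvPolynomial σ R) :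
    contraction Θ k q p = (-1 : R) ^ k • contraction Θ k p q := by
  rw [← contraction_transpose, hΘ, ← neg_one_smul R Θ, contraction_smul_matrix]

lemma contraction_eq_zero_of_totalDegree_lt {k : ℕ} (hk : q.totalDegree < k)
    (p : MvPolynomial σ R) : contraction Θ k p q = 0 := by
  induction k generalizing p q with
  | zero => exact absurd hk (Nat.not_lt_zero _)
  | succ k ih =>
    rw [contraction_succ_apply]
    refine Finset.sum_eq_zero fun i _ => Finset.sum_eq_zero fun j _ => ?_
    by_cases hj : MvPolynomial.pderiv j q = 0
    · rw [hj, map_zero, smul_zero]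
    · rw [ih ((totalDegree_pderiv_lt hj).trans_le (Nat.lt_succ_iff.1 hk)), smul_zero]

lemma totalDegree_contraction_le (Θ : Matrix σ σ R) (k : ℕ) (p q : MvPolynomial σ R) :
    (contraction Θ k p q).totalDegree ≤ p.totalDegree + q.totalDegree - 2 * k := by
  induction k generalizing p q with
  | zero => exact MvPolynomial.totalDegree_mul p q
  | succ k ih =>
    rw [contraction_succ_apply]
    refine MvPolynomial.totalDegree_finsetSum_le fun i _ =>
      MvPolynomial.totalDegree_finsetSum_le fun j _ =>
        (MvPolynomial.totalDegree_smul_le _ _).trans ?_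
    by_cases hi : MvPolynomial.pderiv i p = 0
    · simp [hi]
    by_cases hj : MvPolynomial.pderiv j q = 0
    · simp [hj]
    have := ih (MvPolynomial.pderiv i p) (MvPolynomial.pderiv j q)
    have := totalDegree_pderiv_lt hi
    have := totalDegree_pderiv_lt hj
    lia

lemma contraction_succ_mul_X (Θ : Matrix σ σ R) (k : ℕ) (p q : MvPolynomial σ R) (j : σ) :
    contraction Θ (k + 1) p (q * .X j) = contraction Θ (k + 1) p q * .X j +
      (k + 1) • contraction Θ k (∑ i, Θ i j • MvPolynomial.pderiv i p) q := by
  classical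
  have leibniz (k : ℕ) (p q : MvPolynomial σ R) : contraction Θ (k + 1) p (q * .X j) =
      ∑ i, ∑ l, Θ i l • contraction Θ k (MvPolynomial.pderiv i p)
        (MvPolynomial.pderiv l q * .X j) +
      contraction Θ k (∑ i, Θ i j • MvPolynomial.pderiv i p) q := by
    simp only [contraction_succ_apply, MvPolynomial.pderiv_mul, map_add, smul_add,
      Finset.sum_add_distrib]
    congr 1
    simp [MvPolynomial.pderiv_X, Pi.single_apply, apply_ite]
  induction k generalizing p q with
  | zero =>
    simp only [leibniz, contraction_succ_apply, contraction_zero_apply, Finset.sum_mul,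
      smul_mul_assoc, mul_assoc, zero_add, one_smul]
  | succ k ih =>
    have push : ∑ i, ∑ l, Θ i l • contraction Θ k
        (∑ m, Θ m j • MvPolynomial.pderiv m (MvPolynomial.pderiv i p)) (MvPolynomial.pderiv l q) =
          contraction Θ (k + 1) (∑ m, Θ m j • MvPolynomial.pderiv m p) q := by
      rw [contraction_succ_apply]
      simp only [map_sum, Derivation.map_smul, fun m i => pderiv_comm i m p]
    rw [leibniz, succ_nsmul _ (k + 1), ← push, ← add_assoc]
    congr 1
    simp only [ih, contraction_succ_apply _ (k + 1) p q, smul_add, Finset.sum_add_distrib,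
      Finset.sum_mul, smul_mul_assoc, Finset.smul_sum, smul_comm (k + 1)]

lemma pderiv_contraction (Θ : Matrix σ σ R) (k : ℕ) (l : σ) (p q : MvPolynomial σ R) :
    MvPolynomial.pderiv l (contraction Θ k p q) =
      contraction Θ k (MvPolynomial.pderiv l p) q +
        contraction Θ k p (MvPolynomial.pderiv l q) := by
  induction k generalizing p q with
  | zero =>
    simp only [contraction_zero_apply, MvPolynomial.pderiv_mul]
  | succ k ih =>
    simp only [contraction_succ_apply, map_sum, Derivation.map_smul, ih, smul_add,
      Finset.sum_add_distrib,
      pderiv_comm l]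

lemma contraction_one_mul (Θ : Matrix σ σ R) (p q r : MvPolynomial σ R) :
    contraction Θ 1 p (q * r) = q • contraction Θ 1 p r + r • contraction Θ 1 p q := by
  simp only [contraction_one_apply, MvPolynomial.pderiv_mul, smul_eq_mul, Finset.mul_sum,
    ← Finset.sum_add_distrib]
  refine Finset.sum_congr rfl fun i _ => Finset.sum_congr rfl fun j _ => ?_
  simp only [mul_smul_comm, ← smul_add]
  congr 1
  ring

variable (Θ) in
/-- The Hamiltonian vector field `{p, ·}` of a polynomial `p` for the Poisson bracket of `Θ`. -/
def hamiltonian (p : MvPolynomial σ R) : Derivation R (MvPolynomial σ R) (MvPolynomial σ R) :=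
  Derivation.mk' (contraction Θ 1 p) (contraction_one_mul Θ p)

lemma hamiltonian_apply (Θ : Matrix σ σ R) (p q : MvPolynomial σ R) :
    hamiltonian Θ p q = contraction Θ 1 p q := rfl

lemma hamiltonian_X (Θ : Matrix σ σ R) (p : MvPolynomial σ R) (j : σ) :
    hamiltonian Θ p (.X j) = ∑ i, Θ i j • MvPolynomial.pderiv i p := by
  classical
  simp [hamiltonian_apply, contraction_one_apply, MvPolynomial.pderiv_X, Pi.single_apply]

/-- The Jacobi identity. Both sides are derivations, and on a coordinate `X k` the identity is the
Leibniz rule for the constant-coefficient derivation `{·, X k}` of the Poisson bracket. -/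
lemma commutator_hamiltonian (hΘ : Θᵀ = -Θ) (p q : MvPolynomial σ R) :
    ⁅hamiltonian Θ p, hamiltonian Θ q⁆ = hamiltonian Θ (hamiltonian Θ p q) := by
  refine MvPolynomial.derivation_ext fun k => ?_
  have swap (r s : MvPolynomial σ R) : contraction Θ 1 s r = -contraction Θ 1 r s := by
    simpa using contraction_swap hΘ 1 r s
  simp only [Derivation.commutator_apply, hamiltonian_X]
  simp only [hamiltonian_apply, map_sum, Derivation.map_smul, pderiv_contraction,
    smul_add, Finset.sum_add_distrib, swap _ q, smul_neg, Finset.sum_neg_distrib]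
  abel

end Contraction

noncomputable section PoissonLieAlgebra

variable {σ K : Type*} [Fintype σ] [Field K] [CharZero K] {Θ : Matrix σ σ K}

/-- The Lie ring structure given by the Poisson bracket of an antisymmetric matrix `Θ` on the
polynomials of degree at most two. It is not an instance since it depends on `Θ`. -/
abbrev poissonLieRing (hΘ : Θᵀ = -Θ) : LieRing (MvPolynomial.restrictTotalDegree σ K 2) where
  bracket p q := ⟨contraction Θ 1 p q, by
    have hp := (MvPolynomial.mem_restrictTotalDegree σ 2 _).1 p.2
    have hq := (MvPolynomial.mem_restrictTotalDegree σ 2 _).1 q.2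
    have := totalDegree_contraction_le Θ 1 p.1 q.1
    exact (MvPolynomial.mem_restrictTotalDegree σ 2 _).2 (by lia)⟩
  add_lie p q r := Subtype.ext <| by simp
  lie_add p q r := Subtype.ext <| by simp
  lie_self p := Subtype.ext <| self_eq_neg.1 <| by simpa using contraction_swap hΘ 1 p.1 p.1
  leibniz_lie p q r := Subtype.ext <| by
    have := congr($(commutator_hamiltonian hΘ p.1 q.1) r.1)
    rw [Derivation.commutator_apply, sub_eq_iff_eq_add] at this
    exact this

/-- The Lie algebra structure over `K` on `poissonLieRing`. -/
abbrev poissonLieAlgebra (hΘ : Θᵀ = -Θ) :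
    letI := poissonLieRing hΘ; LieAlgebra K (MvPolynomial.restrictTotalDegree σ K 2) :=
  letI := poissonLieRing hΘ
  { lie_smul := fun c p q => Subtype.ext <| map_smul (contraction Θ 1 p.1) c q.1 }

end PoissonLieAlgebra

noncomputable section MoyalProduct

variable {σ K : Type*} [Fintype σ] [Field K]

/-- The Moyal product `∑ₖ (k!)⁻¹ • contraction Θ k` of polynomials. The series is cut off at the
degree of the second factor, where the contractions start to vanish. -/
def moyalProd (Θ : Matrix σ σ K) (p q : MvPolynomial σ K) : MvPolynomial σ K :=
  ∑ k ∈ Finset.range (q.totalDegree + 1), (k ! : K)⁻¹ • contraction Θ k p q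

variable {Θ : Matrix σ σ K}

lemma moyalProd_eq_sum_range {p q : MvPolynomial σ K} {N : ℕ} (hN : q.totalDegree < N) :
    moyalProd Θ p q = ∑ k ∈ Finset.range N, (k ! : K)⁻¹ • contraction Θ k p q :=
  Finset.sum_subset (Finset.range_mono hN) fun k _ hk => by
    rw [contraction_eq_zero_of_totalDegree_lt (by simpa using hk), smul_zero]

lemma moyalProd_add_right (p q r : MvPolynomial σ K) :
    moyalProd Θ p (q + r) = moyalProd Θ p q + moyalProd Θ p r := by
  have hN := MvPolynomial.totalDegree_add q r
  rw [moyalProd_eq_sum_range (q := q + r) (Nat.lt_succ_of_le hN),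
    moyalProd_eq_sum_range (q := q) (Nat.lt_succ_of_le (le_max_left _ r.totalDegree)),
    moyalProd_eq_sum_range (q := r) (Nat.lt_succ_of_le (le_max_right q.totalDegree _))]
  simp only [map_add, smul_add, Finset.sum_add_distrib]

lemma moyalProd_C (p : MvPolynomial σ K) (c : K) : moyalProd Θ p (.C c) = c • p := by
  simp [moyalProd, contraction_zero_apply, MvPolynomial.smul_eq_C_mul, mul_comm]

lemma moyalProd_mul_X [CharZero K] (p q : MvPolynomial σ K) (j : σ) :
    moyalProd Θ p (q * .X j) = moyalProd Θ p q * .X j +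
      moyalProd Θ (∑ i, Θ i j • MvPolynomial.pderiv i p) q := by
  have hN : (q * .X j).totalDegree < q.totalDegree + 2 := by
    have := MvPolynomial.totalDegree_mul q (.X j)
    have := MvPolynomial.totalDegree_X (R := K) j
    lia
  have factorial_succ (k : ℕ) : ((k + 1)! : K)⁻¹ * (k + 1 : ℕ) = (k ! : K)⁻¹ := by
    have : ((k + 1 : ℕ) : K) ≠ 0 := Nat.cast_ne_zero.2 k.succ_ne_zero
    rw [Nat.factorial_succ, Nat.cast_mul]
    field_simp
  rw [moyalProd_eq_sum_range hN, moyalProd_eq_sum_range (q := q) (N := q.totalDegree + 2) (by lia),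
    Finset.sum_range_succ', Finset.sum_range_succ' _ (q.totalDegree + 1)]
  simp only [contraction_succ_mul_X, contraction_zero_apply, smul_add, Finset.sum_add_distrib,
    add_mul, Finset.sum_mul, smul_mul_assoc, mul_assoc, ← Nat.cast_smul_eq_nsmul K, smul_smul,
    factorial_succ, moyalProd]
  abel

lemma moyalProd_sub_swap [CharZero K] (hΘ : Θᵀ = -Θ) (p : MvPolynomial σ K) {q : MvPolynomial σ K}
    (hq : q.totalDegree ≤ 2) :
    moyalProd Θ p q - moyalProd Θ q p = (2 : K) • contraction Θ 1 p q := by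
  have vanish (k : ℕ) (hk : k ∉ Finset.range 3) : (k ! : K)⁻¹ • contraction Θ k q p = 0 := by
    have : q.totalDegree < k := by simp only [Finset.mem_range] at hk; lia
    rw [contraction_swap hΘ, contraction_eq_zero_of_totalDegree_lt this, smul_zero, smul_zero]
  have hp : moyalProd Θ q p = ∑ k ∈ Finset.range 3, (k ! : K)⁻¹ • contraction Θ k q p := by
    rw [moyalProd_eq_sum_range (N := p.totalDegree + 3) (by lia)]
    exact (Finset.sum_subset (Finset.range_mono (by lia)) fun k _ => vanish k).symm
  rw [hp, moyalProd_eq_sum_range (N := 3) (by lia)]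
  simp [Finset.sum_range_succ, contraction_swap hΘ _ p q, two_smul]

end MoyalProduct

section SchwartzCalculus

variable {E : Type*} [NormedAddCommGroup E] [NormedSpace ℝ E]

lemma lineDerivOp_smulLeftCLM (ℓ : E →L[ℝ] ℂ) (v : E) (f : 𝓢(E, ℂ)) :
    ∂_{v} (SchwartzMap.smulLeftCLM ℂ ℓ f) = SchwartzMap.smulLeftCLM ℂ ℓ (∂_{v} f) + ℓ v • f := by
  ext x
  have hf : (SchwartzMap.smulLeftCLM ℂ ℓ f : E → ℂ) = ℓ * f :=
    funext (SchwartzMap.smulLeftCLM_apply_apply ℓ.hasTemperateGrowth f)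
  simp only [add_apply, smul_apply, lineDerivOp_apply_eq_fderiv,
    SchwartzMap.smulLeftCLM_apply_apply ℓ.hasTemperateGrowth]
  rw [hf, (ℓ.hasFDerivAt.mul (f.hasFDerivAt x)).fderiv]
  simp [mul_comm]

lemma distribution_lineDerivOp_smulLeftCLM (ℓ : E →L[ℝ] ℂ) (v : E) (T : 𝓢'(E, ℂ)) :
    ∂_{v} (TemperedDistribution.smulLeftCLM ℂ ℓ T) =
      TemperedDistribution.smulLeftCLM ℂ ℓ (∂_{v} T) + ℓ v • T := by
  ext f
  have h := congrArg T (lineDerivOp_smulLeftCLM ℓ v f)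
  rw [map_add, map_smul] at h
  simp only [TemperedDistribution.lineDerivOp_apply_apply,
    TemperedDistribution.smulLeftCLM_apply_apply, map_neg, add_apply, smul_apply, h]
  abel

variable [MeasurableSpace E] [BorelSpace E]

lemma smulLeftCLM_toTemperedDistributionCLM [SecondCountableTopology E] (μ : Measure E)
    [μ.HasTemperateGrowth] {g : E → ℂ} (hg : g.HasTemperateGrowth) (f : 𝓢(E, ℂ)) :
    TemperedDistribution.smulLeftCLM ℂ g (toTemperedDistributionCLM E ℂ μ f) =
      toTemperedDistributionCLM E ℂ μ (SchwartzMap.smulLeftCLM ℂ g f) := by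
  ext u
  simp [SchwartzMap.smulLeftCLM_apply_apply hg, mul_left_comm, mul_assoc]

variable [FiniteDimensional ℝ E] {F : Type*} [NormedAddCommGroup F] [NormedSpace ℝ F]
  (μ : Measure E) [μ.IsAddHaarMeasure]

lemma integral_lineDerivOp (v : E) (f : 𝓢(E, F)) : ∫ x, (∂_{v} f) x ∂μ = 0 := by
  have h := integral_smul_fderiv_eq_neg_fderiv_smul_of_integrable (μ := μ) (𝕜 := ℝ)
    (f := fun _ => (1 : ℝ)) (g := f) (v := v) (by simp)
    (by simpa using (∂_{v} f).integrable) (by simpa using f.integrable)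
    (by simp) fun x _ => f.differentiableAt
  simpa [lineDerivOp_apply_eq_fderiv] using h

lemma integral_comp_continuousLinearEquiv (B : E ≃L[ℝ] E) (f : E → F) :
    ∫ y, f (B y) ∂μ = |(B : E →L[ℝ] E).det|⁻¹ • ∫ w, f w ∂μ := by
  have hdet : |(B : E →L[ℝ] E).det| ≠ 0 := abs_ne_zero.2 B.toLinearEquiv.isUnit_det'.ne_zero
  have h := integral_image_eq_integral_abs_det_fderiv_smul μ MeasurableSet.univ
    (fun _ _ => B.hasFDerivWithinAt) B.injective.injOn f
  rw [Set.image_univ, B.surjective.range_eq, setIntegral_univ, setIntegral_univ, integral_smul] at h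
  rw [h, inv_smul_smul₀ hdet]

end SchwartzCalculus

noncomputable section Twist

variable {E : Type} [NormedAddCommGroup E] [InnerProductSpace ℝ E]

lemma phase_sub_self {A : E ≃L[ℝ] E} (hA : ∀ y, inner ℝ y (A y) = 0) (x y : E) :
    phase A (WithLp.toLp 2 (y, x - y)) = phase A (WithLp.toLp 2 (y, x)) := by
  rw [phase_apply, phase_apply, inner_sub_left, hA, sub_zero]

variable [FiniteDimensional ℝ E]

/-- The Schwartz function `(y, x) ↦ exp (2 i ⟪x, A y⟫) G (x + y, y)`, whose integral over `y` is
`twistCLM A G`. -/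
def twistKernelCLM (A : E ≃L[ℝ] E) :
    𝓢(WithLp 2 (E × E), ℂ) →L[ℂ] 𝓢(WithLp 2 (E × E), ℂ) :=
  smulLeftCLM ℂ (phase A) ∘L compCLMOfContinuousLinearEquiv ℂ (shear E)

lemma twistKernelCLM_apply (A : E ≃L[ℝ] E) (G : 𝓢(WithLp 2 (E × E), ℂ)) (x y : E) :
    twistKernelCLM A G (WithLp.toLp 2 (y, x)) =
      phase A (WithLp.toLp 2 (y, x)) * G (WithLp.toLp 2 (x + y, y)) :=
  SchwartzMap.smulLeftCLM_apply_apply (hasTemperateGrowth_phase A) _ _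

variable [MeasurableSpace E] [BorelSpace E]

lemma integrable_slice (G : 𝓢(WithLp 2 (E × E), ℂ)) (x : E) :
    Integrable fun y => G (WithLp.toLp 2 (y, x)) := by
  have hgrowth : (fun y : E => WithLp.toLp 2 (y, x)).HasTemperateGrowth := by
    have h := ((WithLp.prodContinuousLinearEquiv 2 ℝ E E).symm.toContinuousLinearMap ∘L
      ContinuousLinearMap.inl ℝ E E).hasTemperateGrowth.add (.const (WithLp.toLp 2 (0, x)))
    convert h using 2 with y
    refine WithLp.ofLp_injective 2 (Prod.ext ?_ ?_) <;> simp
  have hisom : Isometry fun y : E => WithLp.toLp 2 (y, x) := .of_dist_eq fun y z => by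
    rw [WithLp.prod_dist_eq_of_L2]
    simp
  exact (compCLMOfAntilipschitz ℂ hgrowth hisom.antilipschitz G).integrable

lemma twistCLM_apply_eq_integral (A : E ≃L[ℝ] E) (G : 𝓢(WithLp 2 (E × E), ℂ)) (x : E) :
    twistCLM A G x = ∫ y, twistKernelCLM A G (WithLp.toLp 2 (y, x)) :=
  marginalCLM_apply _ x

lemma smulLeftCLM_twistCLM (ℓ : E →L[ℝ] ℂ) (A : E ≃L[ℝ] E) (a g : 𝓢(E, ℂ)) :
    SchwartzMap.smulLeftCLM ℂ ℓ (twistCLM A (tensorCLM a g)) =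
      twistCLM A (tensorCLM (SchwartzMap.smulLeftCLM ℂ ℓ a) g) -
        twistCLM A (tensorCLM a (SchwartzMap.smulLeftCLM ℂ ℓ g)) := by
  have hℓ := SchwartzMap.smulLeftCLM_apply_apply (F := ℂ) ℓ.hasTemperateGrowth
  ext x
  rw [hℓ, sub_apply, twistCLM_apply_eq_integral, twistCLM_apply_eq_integral,
    twistCLM_apply_eq_integral, ← integral_sub (integrable_slice ..) (integrable_slice ..),
    ← integral_smul]
  congr 1
  ext y
  simp only [twistKernelCLM_apply, tensorCLM_apply, hℓ, WithLp.toLp_fst, WithLp.toLp_snd, map_add,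
    smul_eq_mul]
  ring

lemma scaledFourierCLM_lineDerivOp {A : E ≃L[ℝ] E} {ℓ : E →L[ℝ] ℂ} {w : E}
    (hℓ : ∀ y, ℓ y = (inner ℝ (A y) w : ℝ)) (b : 𝓢(E, ℂ)) :
    scaledFourierCLM A (∂_{w} b) =
      (2 * Complex.I) • SchwartzMap.smulLeftCLM ℂ ℓ (scaledFourierCLM A b) := by
  ext y
  change (𝓕 (∂_{w} b) : 𝓢(E, ℂ)) (Real.pi⁻¹ • A y) =
    (2 * Complex.I) • SchwartzMap.smulLeftCLM ℂ ℓ (scaledFourierCLM A b) y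
  have hinner : (fun ξ : E => inner ℝ ξ w).HasTemperateGrowth := by fun_prop
  rw [fourier_lineDerivOp_eq, smul_apply, SchwartzMap.smulLeftCLM_apply_apply hinner,
    SchwartzMap.smulLeftCLM_apply_apply ℓ.hasTemperateGrowth, hℓ, real_inner_smul_left]
  change _ = (2 * Complex.I) • _ • (𝓕 b : 𝓢(E, ℂ)) (Real.pi⁻¹ • A y)
  have hpi : (Real.pi : ℂ) ≠ 0 := Complex.ofReal_ne_zero.2 Real.pi_ne_zero
  simp only [smul_eq_mul, Complex.real_smul, Complex.ofReal_mul, Complex.ofReal_inv]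
  field_simp

lemma smulLeftCLM_twistCLM_scaledFourierCLM {A : E ≃L[ℝ] E} {ℓ : E →L[ℝ] ℂ} {w : E}
    (hℓ : ∀ y, ℓ y = (inner ℝ (A y) w : ℝ)) (a b : 𝓢(E, ℂ)) :
    SchwartzMap.smulLeftCLM ℂ ℓ (twistCLM A (tensorCLM a (scaledFourierCLM A b))) =
      twistCLM A (tensorCLM (SchwartzMap.smulLeftCLM ℂ ℓ a) (scaledFourierCLM A b)) +
        (Complex.I / 2) • twistCLM A (tensorCLM a (scaledFourierCLM A (∂_{w} b))) := by
  have hI : Complex.I / 2 * (2 * Complex.I) = -1 := by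
    linear_combination Complex.I_mul_I
  rw [smulLeftCLM_twistCLM, scaledFourierCLM_lineDerivOp hℓ, map_smul, map_smul, smul_smul, hI,
    neg_one_smul, sub_eq_add_neg]

lemma integral_twistCLM {A : E ≃L[ℝ] E} (hA : ∀ y, inner ℝ y (A y) = 0)
    (G : 𝓢(WithLp 2 (E × E), ℂ)) :
    ∫ x, twistCLM A G x =
      ∫ x, ∫ y, phase A (WithLp.toLp 2 (y, x)) * G (WithLp.toLp 2 (x, y)) := by
  have hint : Integrable (fun p : E × E => phase A (WithLp.toLp 2 p) * G (WithLp.toLp 2 p.swap))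
      (volume.prod volume) := by
    have h := integrable_prod (SchwartzMap.smulLeftCLM ℂ (phase A)
      (compCLMOfContinuousLinearEquiv ℂ (swap E) G))
    simp only [SchwartzMap.smulLeftCLM_apply_apply (hasTemperateGrowth_phase A)] at h
    exact h
  calc ∫ x, twistCLM A G x
      = ∫ y, ∫ x, twistKernelCLM A G (WithLp.toLp 2 (y, x)) := by
        simp only [twistCLM_apply_eq_integral]
        exact integral_integral_swap (integrable_prod (twistKernelCLM A G)).swap
    _ = ∫ y, ∫ x, phase A (WithLp.toLp 2 (y, x)) * G (WithLp.toLp 2 (x, y)) := by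
        congr 1
        ext y
        rw [← integral_sub_right_eq_self _ y]
        simp only [twistKernelCLM_apply, sub_add_cancel, phase_sub_self hA]
    _ = ∫ x, ∫ y, phase A (WithLp.toLp 2 (y, x)) * G (WithLp.toLp 2 (x, y)) :=
        integral_integral_swap hint

lemma integral_phase_mul_scaledFourierCLM (A : E ≃L[ℝ] E) (b : 𝓢(E, ℂ)) (x : E) :
    ∫ y, phase A (WithLp.toLp 2 (y, x)) * scaledFourierCLM A b y =
      ((Real.pi ^ Module.finrank ℝ E * |(A : E →L[ℝ] E).det|⁻¹ : ℝ) : ℂ) * b x := by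
  have hinv : ∫ w, Real.fourierChar (inner ℝ w x) • (𝓕 b : 𝓢(E, ℂ)) w = b x := by
    rw [← Real.fourierInv_eq, ← SchwartzMap.fourierInv_coe, fourierInv_fourier_eq]
  have hphase (y : E) :
      phase A (WithLp.toLp 2 (y, x)) * scaledFourierCLM A b y =
        Real.fourierChar (inner ℝ (Real.pi⁻¹ • A y) x) •
          (𝓕 b : 𝓢(E, ℂ)) (Real.pi⁻¹ • A y) := by
    have hpi : (Real.pi : ℂ) ≠ 0 := Complex.ofReal_ne_zero.2 Real.pi_ne_zero
    rw [Circle.smul_def, smul_eq_mul, Real.fourierChar_apply, phase_apply, real_inner_smul_left,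
      real_inner_comm]
    change _ * (𝓕 b : 𝓢(E, ℂ)) (Real.pi⁻¹ • A y) = _
    congr 2
    push_cast
    field_simp
  simp_rw [hphase]
  rw [integral_comp_continuousLinearEquiv volume A
    fun w => Real.fourierChar (inner ℝ (Real.pi⁻¹ • w) x) • (𝓕 b : 𝓢(E, ℂ)) (Real.pi⁻¹ • w),
    Measure.integral_comp_smul volume
      fun w => Real.fourierChar (inner ℝ w x) • (𝓕 b : 𝓢(E, ℂ)) w, hinv, smul_smul,
    Complex.real_smul, inv_pow, inv_inv, abs_of_pos (pow_pos Real.pi_pos _),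
    mul_comm |_|⁻¹]

lemma integral_twistCLM_scaledFourierCLM {A : E ≃L[ℝ] E} (hA : ∀ y, inner ℝ y (A y) = 0)
    (a b : 𝓢(E, ℂ)) :
    ∫ x, twistCLM A (tensorCLM a (scaledFourierCLM A b)) x =
      ((Real.pi ^ Module.finrank ℝ E * |(A : E →L[ℝ] E).det|⁻¹ : ℝ) : ℂ) * ∫ x, a x * b x := by
  rw [integral_twistCLM hA, ← integral_const_mul]
  congr 1
  ext x
  simp only [tensorCLM_apply, mul_left_comm _ (a x), WithLp.toLp_fst, WithLp.toLp_snd]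
  rw [integral_const_mul, integral_phase_mul_scaledFourierCLM, mul_left_comm]

end Twist

noncomputable section StarProduct

variable {n : ℕ} {θ : ℝ}

/-- The `j`-th coordinate of `ℝ ^ D`, complex valued so as to act on Schwartz functions and
tempered distributions through `smulLeftCLM`. -/
def coord (j : Fin 2 × Fin n) : Space n →L[ℝ] ℂ :=
  Complex.ofRealCLM ∘L EuclideanSpace.proj j

lemma coord_apply (j : Fin 2 × Fin n) (x : Space n) : coord j x = x j := rfl

variable (θ) in
/-- The `j`-th column of `Θ`: the direction in which multiplication by `x_j` differentiates the
second factor of a Moyal product. -/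
def thetaCol (j : Fin 2 × Fin n) : Space n := WithLp.toLp 2 ((theta n θ).col j)

lemma inner_invEquiv_thetaCol (hθ : θ ≠ 0) (j : Fin 2 × Fin n) (y : Space n) :
    inner ℝ (invEquiv n hθ y) (thetaCol θ j) = y j := by
  rw [real_inner_comm, inner_invEquiv, thetaCol, ← Matrix.mulVec_single_one, Matrix.mulVec_mulVec,
    mul_eq_one_comm.1 (theta_mul_inv hθ), Matrix.one_mulVec, dotProduct_single_one]

lemma transpose_theta (n : ℕ) (θ : ℝ) : (theta n θ)ᵀ = -theta n θ := by
  have hJ : (!![0, -1; 1, 0] : Matrix (Fin 2) (Fin 2) ℝ)ᵀ = -!![0, -1; 1, 0] := by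
    ext i j
    fin_cases i <;> fin_cases j <;> simp
  rw [theta, sigma, Matrix.transpose_smul, Matrix.blockDiagonal_transpose, hJ, ← smul_neg,
    ← Matrix.blockDiagonal_neg]
  rfl

lemma inner_invEquiv_self (hθ : θ ≠ 0) (y : Space n) : inner ℝ y (invEquiv n hθ y) = 0 := by
  have hinv : ((theta n θ)⁻¹)ᵀ = -(theta n θ)⁻¹ := by
    rw [Matrix.transpose_nonsing_inv, transpose_theta]
    exact Matrix.inv_eq_right_inv (by rw [neg_mul_neg, theta_mul_inv hθ])
  have h : y.ofLp ⬝ᵥ (theta n θ)⁻¹ *ᵥ y.ofLp = -(y.ofLp ⬝ᵥ (theta n θ)⁻¹ *ᵥ y.ofLp) := by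
    conv_lhs => rw [dotProduct_comm, ← Matrix.vecMul_transpose, hinv, Matrix.vecMul_neg,
      neg_dotProduct, ← Matrix.dotProduct_mulVec]
  rw [inner_invEquiv]
  linarith

lemma det_theta (n : ℕ) (θ : ℝ) : (theta n θ).det = θ ^ (2 * n) := by
  rw [theta, Matrix.det_smul, sigma, Matrix.det_blockDiagonal]
  simp [Matrix.det_fin_two]

lemma det_invEquiv (hθ : θ ≠ 0) :
    (invEquiv n hθ : Space n →L[ℝ] Space n).det = (θ ^ (2 * n))⁻¹ := by
  change LinearMap.det (Matrix.toLpLin 2 2 ((theta n θ)⁻¹)ᵀ) = _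
  rw [LinearMap.det_toLpLin, Matrix.det_transpose, Matrix.det_nonsing_inv, det_theta,
    Ring.inverse_eq_inv']

variable [NeZero θ]

lemma coord_star (j : Fin 2 × Fin n) (a b : 𝓢(Space n, ℂ)) :
    SchwartzMap.smulLeftCLM ℂ (coord j) (star θ a b) =
      star θ (SchwartzMap.smulLeftCLM ℂ (coord j) a) b +
        (Complex.I / 2) • star θ a (∂_{thetaCol θ j} b) := by
  have hcoord (y : Space n) :
      coord j y = (inner ℝ (invEquiv n (NeZero.ne θ) y) (thetaCol θ j) : ℝ) := by
    rw [inner_invEquiv_thetaCol, coord_apply]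
  simp only [star_eq_left, starAuxLeft, smul_apply,
    ContinuousLinearMap.comp_apply, map_smul, smulLeftCLM_twistCLM_scaledFourierCLM hcoord]
  rw [smul_add, smul_comm]

lemma integral_star (a b : 𝓢(Space n, ℂ)) : ∫ x, star θ a b x = ∫ x, a x * b x := by
  have hconst : ((Real.pi ^ Module.finrank ℝ (Space n) *
      |(invEquiv n (NeZero.ne θ) : Space n →L[ℝ] Space n).det|⁻¹ : ℝ) : ℂ) =
        ((Real.pi * θ) ^ (2 * n) : ℝ) := by
    rw [det_invEquiv, abs_inv, inv_inv, abs_of_nonneg ((even_two_mul n).pow_nonneg θ),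
      finrank_euclideanSpace, Fintype.card_prod, Fintype.card_fin, Fintype.card_fin, mul_pow]
  have hne : (((Real.pi * θ) ^ (2 * n) : ℝ) : ℂ) ≠ 0 :=
    Complex.ofReal_ne_zero.2 (pow_ne_zero _ (mul_ne_zero Real.pi_ne_zero (NeZero.ne θ)))
  simp only [star_eq_left, starAuxLeft, smul_apply,
    ContinuousLinearMap.comp_apply, smul_eq_mul]
  rw [integral_const_mul, integral_twistCLM_scaledFourierCLM (inner_invEquiv_self _), hconst,
    inv_mul_cancel_left₀ hne]

end StarProduct

noncomputable section Multipliers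

variable {n : ℕ} {θ : ℝ}

lemma polyDist_C (c : ℂ) (f : 𝓢(Space n, ℂ)) :
    polyDist (MvPolynomial.C c) f = c * ∫ x, f x := by
  simp [polyDist_apply, polyFun, mul_comm _ c, integral_const_mul]

lemma polyDist_mul_X (p : MvPolynomial (Fin 2 × Fin n) ℂ) (j : Fin 2 × Fin n) :
    polyDist (p * MvPolynomial.X j) =
      TemperedDistribution.smulLeftCLM ℂ (coord j) (polyDist p) := by
  ext f
  rw [TemperedDistribution.smulLeftCLM_apply_apply, polyDist_apply, polyDist_apply]
  congr 1
  ext x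
  rw [SchwartzMap.smulLeftCLM_apply_apply (coord j).hasTemperateGrowth]
  simp only [polyFun, map_mul, MvPolynomial.eval_X, coord_apply, smul_eq_mul]
  ring

lemma lineDerivOp_polyDist (v : Space n) (p : MvPolynomial (Fin 2 × Fin n) ℂ) :
    ∂_{v} (polyDist p) = polyDist (∑ i, (v i : ℂ) • MvPolynomial.pderiv i p) := by
  induction p using MvPolynomial.induction_on with
  | C c =>
    ext f
    simp [TemperedDistribution.lineDerivOp_apply_apply, polyDist_C, integral_neg,
      integral_lineDerivOp]
  | add p q hp hq =>
    simp only [map_add, lineDerivOp_add, hp, hq, smul_add, Finset.sum_add_distrib]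
  | mul_X p j hp =>
    have hX : ∑ i, (v i : ℂ) • (p * MvPolynomial.pderiv i (MvPolynomial.X j)) = (v j : ℂ) • p := by
      rw [Finset.sum_eq_single_of_mem j (Finset.mem_univ j) fun i _ hij => by
        rw [MvPolynomial.pderiv_X_of_ne hij.symm, mul_zero, smul_zero],
        MvPolynomial.pderiv_X_self, mul_one]
    rw [polyDist_mul_X, distribution_lineDerivOp_smulLeftCLM, hp, ← polyDist_mul_X, coord_apply,
      ← map_smul, ← map_add]
    congr 1
    simp only [Derivation.leibniz, smul_add, Finset.sum_add_distrib, smul_eq_mul]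
    rw [hX, Finset.sum_mul, add_comm]
    congr 1
    refine Finset.sum_congr rfl fun i _ => ?_
    rw [smul_mul_assoc, mul_comm]

variable (n θ) in
/-- The matrix `Θ` over `ℂ`, acting on polynomials with complex coefficients. -/
def complexTheta : Matrix (Fin 2 × Fin n) (Fin 2 × Fin n) ℂ := (theta n θ).map Complex.ofReal

lemma transpose_smul_complexTheta (n : ℕ) (θ : ℝ) (c : ℂ) :
    (c • complexTheta n θ)ᵀ = -(c • complexTheta n θ) := by
  rw [complexTheta, Matrix.transpose_smul, ← Matrix.transpose_map, transpose_theta, ← smul_neg]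
  congr 1
  ext i j
  simp

lemma contraction_smul_complexTheta (c : ℂ) (p q : MvPolynomial (Fin 2 × Fin n) ℂ) :
    contraction (c • complexTheta n θ) 1 p q = c • poisson θ p q := by
  rw [contraction_smul_matrix, pow_one, contraction_one_apply, poisson]
  simp only [MvPolynomial.smul_eq_C_mul, mul_assoc]
  rfl

variable [NeZero θ]

lemma distStar_smulLeftCLM_coord (j : Fin 2 × Fin n) (T : 𝓢'(Space n, ℂ)) (a : 𝓢(Space n, ℂ)) :
    distStar θ (TemperedDistribution.smulLeftCLM ℂ (coord j) T) a =
      distStar θ T (SchwartzMap.smulLeftCLM ℂ (coord j) a) -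
        (Complex.I / 2) • ∂_{thetaCol θ j} (distStar θ T a) := by
  ext b
  simp only [sub_apply, smul_apply, distStar_apply, TemperedDistribution.smulLeftCLM_apply_apply,
    TemperedDistribution.lineDerivOp_apply_apply, coord_star, map_add, map_smul, map_neg, smul_neg,
    sub_neg_eq_add]

lemma starDist_smulLeftCLM_coord (j : Fin 2 × Fin n) (T : 𝓢'(Space n, ℂ)) (a : 𝓢(Space n, ℂ)) :
    starDist θ a (TemperedDistribution.smulLeftCLM ℂ (coord j) T) =
      TemperedDistribution.smulLeftCLM ℂ (coord j) (starDist θ a T) +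
        (Complex.I / 2) • starDist θ (∂_{thetaCol θ j} a) T := by
  ext b
  simp only [add_apply, smul_apply, starDist_apply, TemperedDistribution.smulLeftCLM_apply_apply,
    coord_star, map_add, map_smul]

lemma distStar_C (c : ℂ) (a : 𝓢(Space n, ℂ)) :
    distStar θ (polyDist (MvPolynomial.C c)) a = emb (c • a) := by
  ext b
  rw [distStar_apply, polyDist_C, integral_star, map_smul, smul_apply, smul_eq_mul]
  simp only [toTemperedDistributionCLM_apply_apply, smul_eq_mul, mul_comm]

lemma starDist_C (c : ℂ) (a : 𝓢(Space n, ℂ)) :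
    starDist θ a (polyDist (MvPolynomial.C c)) = emb (c • a) := by
  ext b
  rw [starDist_apply, polyDist_C, integral_star, map_smul, smul_apply, smul_eq_mul]
  simp only [toTemperedDistributionCLM_apply_apply, smul_eq_mul]

lemma smulLeftCLM_coord_mem_moyalAlgebra (j : Fin 2 × Fin n) {T : 𝓢'(Space n, ℂ)}
    (hT : T ∈ moyalAlgebra n θ) :
    TemperedDistribution.smulLeftCLM ℂ (coord j) T ∈ moyalAlgebra n θ := by
  refine ⟨fun a => ?_, fun a => ?_⟩
  · obtain ⟨f, hf⟩ := hT.1 a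
    obtain ⟨g, hg⟩ := hT.1 (∂_{thetaCol θ j} a)
    refine ⟨SchwartzMap.smulLeftCLM ℂ (coord j) f + (Complex.I / 2) • g, ?_⟩
    rw [starDist_smulLeftCLM_coord, map_add, map_smul, ← hf, ← hg,
      smulLeftCLM_toTemperedDistributionCLM volume (coord j).hasTemperateGrowth]
  · obtain ⟨f, hf⟩ := hT.2 (SchwartzMap.smulLeftCLM ℂ (coord j) a)
    obtain ⟨g, hg⟩ := hT.2 a
    refine ⟨f - (Complex.I / 2) • ∂_{thetaCol θ j} g, ?_⟩
    rw [distStar_smulLeftCLM_coord, map_sub, map_smul, ← hf, ← hg,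
      TemperedDistribution.lineDerivOp_toTemperedDistributionCLM_eq]

lemma polyDist_mem_moyalAlgebra (p : MvPolynomial (Fin 2 × Fin n) ℂ) :
    polyDist p ∈ moyalAlgebra n θ := by
  induction p using MvPolynomial.induction_on with
  | C c => exact ⟨fun a => ⟨c • a, (starDist_C c a).symm⟩, fun a => ⟨c • a, (distStar_C c a).symm⟩⟩
  | add p q hp hq => rw [map_add]; exact add_mem hp hq
  | mul_X p j hp => rw [polyDist_mul_X]; exact smulLeftCLM_coord_mem_moyalAlgebra j hp

lemma act_eq {T : moyalAlgebra n θ} {a f : 𝓢(Space n, ℂ)} (h : emb f = distStar θ T.1 a) :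
    act T a = f :=
  emb_injective ((emb_act T a).trans h.symm)

lemma act_add (S T : moyalAlgebra n θ) : act (S + T) = act S + act T := by
  ext1 a
  refine act_eq ?_
  rw [LinearMap.add_apply, map_add, emb_act, emb_act]
  rfl

variable (θ) in
/-- Polynomial functions as elements of the Moyal algebra. -/
def polyMoyal : MvPolynomial (Fin 2 × Fin n) ℂ →ₗ[ℂ] moyalAlgebra n θ :=
  polyDist.codRestrict _ polyDist_mem_moyalAlgebra

lemma coe_polyMoyal (p : MvPolynomial (Fin 2 × Fin n) ℂ) : (polyMoyal θ p).1 = polyDist p := rfl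

lemma act_polyMoyal_C (c : ℂ) (a : 𝓢(Space n, ℂ)) :
    act (polyMoyal θ (MvPolynomial.C c)) a = c • a :=
  act_eq (distStar_C c a).symm

lemma act_polyMoyal_mul_X (p : MvPolynomial (Fin 2 × Fin n) ℂ) (j : Fin 2 × Fin n)
    (a : 𝓢(Space n, ℂ)) :
    act (polyMoyal θ (p * MvPolynomial.X j)) a =
      act (polyMoyal θ p) (SchwartzMap.smulLeftCLM ℂ (coord j) a) -
        (Complex.I / 2) • ∂_{thetaCol θ j} (act (polyMoyal θ p) a) := by
  refine act_eq ?_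
  rw [map_sub, map_smul, ← TemperedDistribution.lineDerivOp_toTemperedDistributionCLM_eq, emb_act,
    emb_act, coe_polyMoyal, coe_polyMoyal, polyDist_mul_X, distStar_smulLeftCLM_coord]

lemma mul_polyMoyal_add (p q r : MvPolynomial (Fin 2 × Fin n) ℂ) (a : 𝓢(Space n, ℂ)) :
    mul (polyMoyal θ p) (polyMoyal θ (q + r)) a =
      mul (polyMoyal θ p) (polyMoyal θ q) a + mul (polyMoyal θ p) (polyMoyal θ r) a := by
  change polyDist p (act _ a) = polyDist p (act _ a) + polyDist p (act _ a)
  rw [map_add, act_add, LinearMap.add_apply, map_add]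

lemma mul_polyMoyal_mul_X (p q : MvPolynomial (Fin 2 × Fin n) ℂ) (j : Fin 2 × Fin n)
    (a : 𝓢(Space n, ℂ)) :
    mul (polyMoyal θ p) (polyMoyal θ (q * MvPolynomial.X j)) a =
      mul (polyMoyal θ p) (polyMoyal θ q) (SchwartzMap.smulLeftCLM ℂ (coord j) a) +
        mul (polyMoyal θ (∑ i, ((Complex.I / 2) • complexTheta n θ) i j • MvPolynomial.pderiv i p))
          (polyMoyal θ q) a := by
  have hderiv : ∑ i, ((Complex.I / 2) • complexTheta n θ) i j • MvPolynomial.pderiv i p =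
      (Complex.I / 2) • ∑ i, (thetaCol θ j i : ℂ) • MvPolynomial.pderiv i p := by
    simp only [Finset.smul_sum, smul_smul]
    rfl
  calc mul (polyMoyal θ p) (polyMoyal θ (q * MvPolynomial.X j)) a
      = mul (polyMoyal θ p) (polyMoyal θ q) (SchwartzMap.smulLeftCLM ℂ (coord j) a) +
          (Complex.I / 2) * (∂_{thetaCol θ j} (polyDist p)) (act (polyMoyal θ q) a) := by
        change polyDist p (act _ a) = polyDist p (act _ _) + _
        rw [act_polyMoyal_mul_X, map_sub, map_smul, TemperedDistribution.lineDerivOp_apply_apply,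
          map_neg, mul_neg, sub_eq_add_neg, smul_eq_mul]
    _ = _ := by
        rw [lineDerivOp_polyDist, hderiv, map_smul]
        rfl

lemma mul_polyMoyal_apply (p q : MvPolynomial (Fin 2 × Fin n) ℂ) (a : 𝓢(Space n, ℂ)) :
    mul (polyMoyal θ p) (polyMoyal θ q) a =
      polyDist (moyalProd ((Complex.I / 2) • complexTheta n θ) p q) a := by
  induction q using MvPolynomial.induction_on generalizing p a with
  | C c =>
    change polyDist p (act _ a) = _
    rw [act_polyMoyal_C, moyalProd_C, map_smul, map_smul]
    rfl
  | add q r hq hr =>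
    rw [mul_polyMoyal_add, hq, hr, moyalProd_add_right, map_add]
    rfl
  | mul_X q j hq =>
    rw [mul_polyMoyal_mul_X, hq, hq, moyalProd_mul_X, map_add, polyDist_mul_X]
    rfl

lemma bracket_polyMoyal (p : MvPolynomial (Fin 2 × Fin n) ℂ) {q : MvPolynomial (Fin 2 × Fin n) ℂ}
    (hq : q.totalDegree ≤ 2) :
    bracket (polyMoyal θ p) (polyMoyal θ q) =
      Complex.I • (polyDist (poisson θ p q)).toLinearMap := by
  ext1 a
  have hsub := moyalProd_sub_swap (transpose_smul_complexTheta n θ (Complex.I / 2)) p hq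
  rw [contraction_smul_complexTheta, smul_smul, mul_div_cancel₀ _ two_ne_zero] at hsub
  have h := congr(polyDist $hsub a)
  rw [map_sub, map_smul] at h
  rw [bracket, LinearMap.sub_apply, mul_polyMoyal_apply, mul_polyMoyal_apply]
  exact h

end Multipliers

noncomputable section LieAlgebra

variable {n : ℕ} {θ : ℝ}

lemma continuous_polyFun (p : MvPolynomial (Fin 2 × Fin n) ℂ) : Continuous (polyFun p) :=
  (hasTemperateGrowth_polyFun p).1.continuous

lemma polyDist_injective : Function.Injective (polyDist (n := n)) := by
  refine (injective_iff_map_eq_zero _).2 fun p hp => ?_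
  have hae : ∀ᵐ x : Space n, polyFun p x = 0 := by
    refine ae_eq_zero_of_integral_contDiff_smul_eq_zero (continuous_polyFun p).locallyIntegrable
      fun g hg hsupp => ?_
    have h := congr($hp ((hsupp.comp_left (g := Complex.ofReal) Complex.ofReal_zero).toSchwartzMap
      (Complex.ofRealCLM.contDiff.comp hg)))
    exact h
  have hzero := (continuous_polyFun p).ae_eq_iff_eq volume continuous_const |>.1 hae
  refine MvPolynomial.funext_set (fun _ => Set.range Complex.ofReal)
    (fun _ => Set.infinite_range_of_injective Complex.ofReal_injective) fun x hx => ?_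
  choose y hy using fun i => hx i (Set.mem_univ i)
  have h := congr($hzero (WithLp.toLp 2 y))
  simpa only [polyFun, hy, map_zero] using h

variable (n) in
/-- Polynomials of degree at most two, identified with the distributions in `𝓟₂`. -/
def polyTwoEquiv : MvPolynomial.restrictTotalDegree (Fin 2 × Fin n) ℂ 2 ≃ₗ[ℂ] polyTwo n :=
  Submodule.equivMapOfInjective polyDist polyDist_injective _

variable (n θ) in
/-- The Lie ring of polynomials of degree at most two under `i` times the Poisson bracket of `Θ`. -/
abbrev polyTwoLieRing : LieRing (MvPolynomial.restrictTotalDegree (Fin 2 × Fin n) ℂ 2) :=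
  poissonLieRing (transpose_smul_complexTheta n θ Complex.I)

variable [NeZero θ]

variable (n θ) in
lemma range_polyDist_le_moyalAlgebra : LinearMap.range polyDist ≤ moyalAlgebra n θ := by
  rintro _ ⟨p, rfl⟩
  exact polyDist_mem_moyalAlgebra p

variable (n θ) in
lemma polyTwo_le_moyalAlgebra : polyTwo n ≤ moyalAlgebra n θ :=
  LinearMap.map_le_range.trans (range_polyDist_le_moyalAlgebra n θ)

lemma bracket_polyTwoEquiv (p q : MvPolynomial.restrictTotalDegree (Fin 2 × Fin n) ℂ 2) :
    letI := polyTwoLieRing n θ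
    bracket (Submodule.inclusion (polyTwo_le_moyalAlgebra n θ) (polyTwoEquiv n p))
      (Submodule.inclusion (polyTwo_le_moyalAlgebra n θ) (polyTwoEquiv n q)) =
        (polyTwoEquiv n ⁅p, q⁆).1.toLinearMap := by
  refine (bracket_polyMoyal p.1 ((MvPolynomial.mem_restrictTotalDegree _ _ _).1 q.2)).trans ?_
  change _ = (polyDist (contraction (Complex.I • complexTheta n θ) 1 p.1 q.1)).toLinearMap
  rw [contraction_smul_complexTheta, map_smul]
  rfl

end LieAlgebra

end Moyal

open Moyal in
theorem mainTheorem7_general (n : ℕ) (θ : ℝ) [NeZero θ] :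
    ∃ h : LinearMap.range polyDist ≤ moyalAlgebra n θ,
      (∀ P Q : polyTwo n, ∃ R : polyTwo n,
        bracket (Submodule.inclusion (LinearMap.map_le_range.trans h) P)
          (Submodule.inclusion (LinearMap.map_le_range.trans h) Q) = R.1.toLinearMap) ∧
      (∃ (𝔤 : Type) (_ : LieRing 𝔤) (_ : LieAlgebra ℂ 𝔤) (e : 𝔤 ≃ₗ[ℂ] polyTwo n),
        ∀ X Y : 𝔤, (e ⁅X, Y⁆).1.toLinearMap =
          bracket (Submodule.inclusion (LinearMap.map_le_range.trans h) (e X))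
            (Submodule.inclusion (LinearMap.map_le_range.trans h) (e Y))) ∧
      (∀ p q : MvPolynomial (Fin 2 × Fin n) ℂ, q.totalDegree ≤ 2 →
        bracket ⟨polyDist p, h ⟨p, rfl⟩⟩ ⟨polyDist q, h ⟨q, rfl⟩⟩ =
          Complex.I • (polyDist (poisson θ p q)).toLinearMap) := by
  refine ⟨range_polyDist_le_moyalAlgebra n θ, fun P Q => ?_, ?_,
    fun p q hq => bracket_polyMoyal p hq⟩
  · obtain ⟨p, rfl⟩ := (polyTwoEquiv n).surjective P
    obtain ⟨q, rfl⟩ := (polyTwoEquiv n).surjective Q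
    exact ⟨_, bracket_polyTwoEquiv p q⟩
  · exact ⟨_, polyTwoLieRing n θ, poissonLieAlgebra (transpose_smul_complexTheta n θ Complex.I),
      polyTwoEquiv n, fun p q => (bracket_polyTwoEquiv p q).symm⟩

theorem mainTheorem7 (n : ℕ) (θ : ℝ) [NeZero θ] :
    ∃ h : Moyal.polyTwo n ≤ Moyal.moyalAlgebra n θ,
      -- closed under the Moyal bracket
      (∀ P Q : Moyal.polyTwo n, ∃ R : Moyal.polyTwo n,
        Moyal.bracket (Submodule.inclusion h P) (Submodule.inclusion h Q) = R.1.toLinearMap) ∧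
      -- a Lie algebra for the Moyal bracket
      (∃ (𝔤 : Type) (_ : LieRing 𝔤) (_ : LieAlgebra ℂ 𝔤) (e : 𝔤 ≃ₗ[ℂ] Moyal.polyTwo n),
        ∀ X Y : 𝔤, (e ⁅X, Y⁆).1.toLinearMap =
          Moyal.bracket (Submodule.inclusion h (e X)) (Submodule.inclusion h (e Y))) ∧
      -- the Moyal bracket is `i` times the Poisson bracket
      (∀ (p q : MvPolynomial (Fin 2 × Fin n) ℂ) (hp : p.totalDegree ≤ 2) (hq : q.totalDegree ≤ 2),
        Moyal.bracket (⟨Moyal.polyDist p, h (Moyal.polyDist_mem_polyTwo hp)⟩ :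
            Moyal.moyalAlgebra n θ)
          ⟨Moyal.polyDist q, h (Moyal.polyDist_mem_polyTwo hq)⟩ =
        Complex.I • (Moyal.polyDist (Moyal.poisson θ p q)).toLinearMap) := by
  obtain ⟨h, hclosed, hLie, hbracket⟩ := mainTheorem7_general n θ
  exact ⟨LinearMap.map_le_range.trans h, hclosed, hLie, fun p q _ hq => hbracket p q hq⟩
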